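/- For a non-negative integer $m$ and a positive rational number $n$ let $$\mathbf R_C(m,n)=\int_0^\infty \frac{x^m\cos(\pi n x)}{\exp(2\pi\sqrt x)-1}\,dx .$$ For non-negative integers $M\le q$, $N\le p$, complex parameters and $z\ne0$, the Meijer $G$-function is $$G^{M,N}_{p,q}\!\left(z\,\Big|\begin{matrix}\alpha_1,\dots,\alpha_N;\alpha_{N+1},\dots,\alpha_p\\ \beta_1,\dots,\beta_M;\beta_{M+1},\dots,\beta_q\end{matrix}\right)=\frac1{2\pi i}\int_L\frac{\prod_{j=1}^M\Gamma(\beta_j-\zeta)\prod_{j=1}^N\Gamma(1-\alpha_j+\zeta)}{\prod_{j=M+1}^q\Gamma(1-\beta_j+\zeta)\prod_{j=N+1}^p\Gamma(\alpha_j-\zeta)}\,z^\zeta\,d\zeta ,$$ where $L$ is an upward contour from $-i\infty$ to $i\infty$ that has the poles of the $\Gamma(\beta_j-\zeta)$, $j\le M$, on its right and those of the $\Gamma(1-\alpha_j+\zeta)$, $j\le N$, on its left. For all the parameters below $L$ may be taken to be any vertical line that separates these two families of poles; such lines exist, and along each of them the integral converges absolutely and has the same value. Then for every integer $m\ge0$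 and every rational $n>0$ the integral $\mathbf R_C(m,n)$ converges absolutely, and it is the sum of each of the following five (convergent) series: $$\mathbf R_C(m,n)=\frac{2^{4m+\frac52}}{\pi}\sum_{k=0}^\infty\frac1{(2\pi+2\pi k)^{2m+2}}\,G^{1,4}_{4,2}\!\left(\frac{64n^2\pi^2}{(2\pi+2\pi k)^4}\,\Big|\begin{matrix}\frac{2-2m}4,\frac{1-2m}4,\frac{-2m}4,\frac{-1-2m}4;-\\ 0;\frac12\end{matrix}\right)$$ $$=\frac{2^{4m+4}\sqrt n}{\sqrt\pi}\sum_{k=0}^\infty\frac1{(2\pi+2\pi k)^{2m+3}}\,G^{1,4}_{4,2}\!\left(\frac{64n^2\pi^2}{(2\pi+2\pi k)^4}\,\Big|\begin{matrix}\frac{1-2m}4,\frac{-1-2m}4,\frac{-2m}4,\frac{-2-2m}4;-\\ -\frac14;\frac14\end{matrix}\right)$$ $$=\frac{2^{4m-\frac12}}{n\pi^2}\sum_{k=0}^\infty\frac1{(2\pi+2\pi k)^{2m}}\,G^{1,4}_{4,2}\!\left(\frac{64n^2\pi^2}{(2\pi+2\pi k)^4}\,\Big|\begin{matrix}\frac{4-2m}4,\frac{3-2m}4,\frac{2-2m}4,\frac{1-2m}4;-\\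 \frac12;1\end{matrix}\right)$$ $$=n\,2^{4m+\frac{11}2}\sum_{k=0}^\infty\frac1{(2\pi+2\pi k)^{2m+4}}\,G^{1,4}_{4,2}\!\left(\frac{64n^2\pi^2}{(2\pi+2\pi k)^4}\,\Big|\begin{matrix}\frac{-2m}4,\frac{-1-2m}4,\frac{-2-2m}4,\frac{-3-2m}4;-\\ -\frac12;0\end{matrix}\right)$$ $$=\frac{2^{6m+\frac52}}{\pi^3}\sum_{k=0}^\infty\frac1{(2\pi+2\pi k)^{2m+2}}\,G^{2,8}_{8,4}\!\left(\frac{4^8n^4\pi^4}{(2\pi+2\pi k)^8}\,\Big|\begin{matrix}\frac{6-2m}8,\frac{5-2m}8,\frac{4-2m}8,\frac{3-2m}8,\frac{2-2m}8,\frac{1-2m}8,\frac{-2m}8,\frac{-1-2m}8;-\\ 0,\frac12;\frac14,\frac34\end{matrix}\right).$$ -/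

import Mathlib

open scoped Real

noncomputable section

/-- The integrand `x ^ m * cos (π n x) / (exp (2 π √x) - 1)` of Ramanujan's integral. -/
def ramanujanIntegrand (m : ℕ) (n : ℝ) (x : ℝ) : ℝ :=
  x ^ m * Real.cos (π * n * x) / (Real.exp (2 * π * Real.sqrt x) - 1)

/-- Ramanujan's integral `R_C(m, n)`. -/
def ramanujanRC (m : ℕ) (n : ℝ) : ℝ :=
  ∫ x in Set.Ioi (0 : ℝ), ramanujanIntegrand m n x

/-- The Mellin-Barnes integrand of the Meijer function `G^{M,N}_{N+N', M+M'}(z)` with upper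
parameters `a ; a'` (there are `N` and `N'` of them) and lower parameters `b ; b'` (there are `M`
and `M'` of them):
`∏ Γ(b_j - ζ) ∏ Γ(1 - a_j + ζ) / (∏ Γ(1 - b'_j + ζ) ∏ Γ(a'_j - ζ)) * z ^ ζ`. -/
def meijerGIntegrand {N N' M M' : ℕ} (a : Fin N → ℂ) (a' : Fin N' → ℂ)
    (b : Fin M → ℂ) (b' : Fin M' → ℂ) (z ζ : ℂ) : ℂ :=
  ((∏ j, Complex.Gamma (b j - ζ)) * ∏ j, Complex.Gamma (1 - a j + ζ)) /
    ((∏ j, Complex.Gamma (1 - b' j + ζ)) * ∏ j, Complex.Gamma (a' j - ζ)) * z ^ ζ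

/-- The upward vertical line `Re ζ = c` separates the poles `b_j + l` of the factors
`Γ(b_j - ζ)` (to its right) from the poles `a_j - 1 - l` of the factors `Γ(1 - a_j + ζ)`
(to its left), where `l = 0, 1, 2, …`. -/
def MeijerGSeparates {N M : ℕ} (a : Fin N → ℂ) (b : Fin M → ℂ) (c : ℝ) : Prop :=
  (∀ (j : Fin M) (l : ℕ), c < (b j + l).re) ∧ ∀ (j : Fin N) (l : ℕ), (a j - 1 - l).re < c

/-- The contour integral `(1 / (2 π i)) ∫_L … dζ` along the line `L` from `c - i∞` to `c + i∞`. -/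
def meijerGLineIntegral {N N' M M' : ℕ} (a : Fin N → ℂ) (a' : Fin N' → ℂ)
    (b : Fin M → ℂ) (b' : Fin M' → ℂ) (z : ℂ) (c : ℝ) : ℂ :=
  1 / (2 * π * Complex.I) *
    ∫ t : ℝ, meijerGIntegrand a a' b b' z (c + t * Complex.I) * Complex.I

open Classical in
/-- The Meijer function `G^{M,N}_{N+N', M+M'}(z | a ; a' | b ; b')`: the Mellin-Barnes integral
along an upward contour, from `-i∞` to `i∞`, that separates the poles of the `Γ(b_j - ζ)` from
those of the `Γ(1 - a_j + ζ)`. We use the parameters for which a vertical line does so, and take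
such a line as contour (by Cauchy's theorem the choice of the line is immaterial where the integral
converges; see `MeijerGConverges`). Otherwise the value is the placeholder `0`. -/
def meijerG {N N' M M' : ℕ} (a : Fin N → ℂ) (a' : Fin N' → ℂ)
    (b : Fin M → ℂ) (b' : Fin M' → ℂ) (z : ℂ) : ℂ :=
  if h : ∃ c : ℝ, MeijerGSeparates a b c then meijerGLineIntegral a a' b b' z h.choose else 0

/-- The integral that defines `meijerG a a' b b' z` makes sense: there is a vertical line that
separates the two families of poles, and along every such line the integral converges absolutely
and has the same value, `meijerG a a' b b' z`. -/
def MeijerGConverges {N N' M M' : ℕ} (a : Fin N → ℂ) (a' : Fin N' → ℂ)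
    (b : Fin M → ℂ) (b' : Fin M' → ℂ) (z : ℂ) : Prop :=
  (∃ c : ℝ, MeijerGSeparates a b c) ∧
    ∀ c : ℝ, MeijerGSeparates a b c →
      MeasureTheory.Integrable (fun t : ℝ => meijerGIntegrand a a' b b' z (c + t * Complex.I)) ∧
      meijerGLineIntegral a a' b b' z c = meijerG a a' b b' z

end

/-! ### Exponential decay of Γ on vertical lines. -/

section GammaLaplace

open Complex MeasureTheory Set Filter Topology

lemma integrableOn_cpow_mul_exp_neg {s r : ℂ} (hs : 0 < s.re) (hr : 0 < r.re) :
    IntegrableOn (fun t : ℝ => (t : ℂ) ^ (s - 1) * cexp (-(r * t))) (Ioi 0) := by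
  have h : IntegrableOn (fun x : ℝ => x ^ (s.re - 1) * Real.exp (-r.re * x ^ (1 : ℝ))) (Ioi 0) :=
    integrableOn_rpow_mul_exp_neg_mul_rpow (by linarith) one_pos hr
  refine Integrable.mono' h ?_ ?_
  · refine ContinuousOn.aestronglyMeasurable ?_ measurableSet_Ioi
    intro t ht
    refine (ContinuousAt.mul ?_ (by fun_prop)).continuousWithinAt
    exact continuousAt_ofReal_cpow_const _ _ (Or.inr (ne_of_gt ht))
  · filter_upwards [self_mem_ae_restrict measurableSet_Ioi] with t ht
    rw [norm_mul, norm_cpow_eq_rpow_re_of_pos ht, norm_exp]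
    simp

lemma differentiableOn_integral_cpow_mul_exp_neg {s : ℂ} (hs : 0 < s.re) :
    DifferentiableOn ℂ (fun r : ℂ => ∫ t : ℝ in Ioi 0, (t : ℂ) ^ (s - 1) * cexp (-(r * t)))
      {r | 0 < r.re} := by
  intro r₀ hr₀
  have hr₀ : 0 < r₀.re := hr₀
  refine DifferentiableAt.differentiableWithinAt ?_
  have hs' : 0 < (s + 1).re := by simp; linarith
  refine (hasDerivAt_integral_of_dominated_loc_of_deriv_le
    (μ := volume.restrict (Ioi (0 : ℝ)))
    (F := fun (r : ℂ) (t : ℝ) => (t : ℂ) ^ (s - 1) * cexp (-(r * t)))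
    (F' := fun (r : ℂ) (t : ℝ) => (t : ℂ) ^ (s - 1) * (cexp (-(r * t)) * (-t)))
    -- On this neighbourhood of r₀ the factor exp(-rt) is at most exp(-(Re r₀ / 2) t), which yields
    -- a bound independent of r.
    (s := {r : ℂ | r₀.re / 2 < r.re}) (x₀ := r₀)
    (bound := fun t : ℝ => t ^ s.re * Real.exp (-(r₀.re / 2) * t ^ (1 : ℝ)))
    ?_ ?_ ?_ ?_ ?_ ?_ ?_).2.differentiableAt
  · exact (isOpen_lt continuous_const continuous_re).mem_nhds (by simp; linarith)
  · filter_upwards [(isOpen_lt continuous_const continuous_re).mem_nhds hr₀] with r hr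
    exact (integrableOn_cpow_mul_exp_neg hs hr).aestronglyMeasurable
  · exact integrableOn_cpow_mul_exp_neg hs hr₀
  · refine ContinuousOn.aestronglyMeasurable ?_ measurableSet_Ioi
    intro t ht
    refine (ContinuousAt.mul ?_ (by fun_prop)).continuousWithinAt
    exact continuousAt_ofReal_cpow_const _ _ (Or.inr (ne_of_gt ht))
  · filter_upwards [self_mem_ae_restrict measurableSet_Ioi] with t ht r hr
    have ht : 0 < t := ht
    rw [norm_mul, norm_mul, norm_cpow_eq_rpow_re_of_pos ht, norm_exp, norm_neg, norm_real,
      Real.norm_of_nonneg ht.le, mul_left_comm, mul_comm _ (Real.exp _), mul_comm,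
      Real.rpow_one]
    have : t ^ s.re = t ^ (s - 1).re * t := by
      rw [← Real.rpow_add_one ht.ne']; simp
    rw [this]
    have hrr : r₀.re / 2 < r.re := hr
    rw [mul_comm (Real.exp _)]
    refine mul_le_mul_of_nonneg_left (Real.exp_le_exp.mpr ?_) (by positivity)
    simp only [neg_re, mul_re, ofReal_re, ofReal_im, mul_zero, sub_zero, neg_mul]
    nlinarith
  · exact integrableOn_rpow_mul_exp_neg_mul_rpow (by linarith) one_pos (by linarith)
  · refine .of_forall fun t r _ => ?_
    refine HasDerivAt.const_mul _ ?_
    have : HasDerivAt (fun r : ℂ => -(r * t)) (-t : ℂ) r := by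
      simpa using! ((hasDerivAt_id r).mul_const (t : ℂ)).neg
    exact this.cexp

/-- Euler's integral for `Γ(s)` along a ray in the right half-plane. -/
lemma integral_cpow_mul_exp_neg_of_re_pos {s r : ℂ} (hs : 0 < s.re) (hr : 0 < r.re) :
    ∫ t : ℝ in Ioi 0, (t : ℂ) ^ (s - 1) * cexp (-(r * t)) = r ^ (-s) * Gamma s := by
  have hopen : IsOpen {r : ℂ | 0 < r.re} := isOpen_lt continuous_const continuous_re
  have h1 := (differentiableOn_integral_cpow_mul_exp_neg hs).analyticOnNhd hopen
  have h2 : AnalyticOnNhd ℂ (fun r : ℂ => r ^ (-s) * Gamma s) {r | 0 < r.re} := by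
    refine DifferentiableOn.analyticOnNhd (fun r hr => ?_) hopen
    exact ((differentiableAt_id.cpow_const (Or.inl hr)).mul_const _).differentiableWithinAt
  have hconn : IsPreconnected {r : ℂ | 0 < r.re} := (convex_halfSpace_re_gt 0).isPreconnected
  -- Both sides are holomorphic in r, and Euler's integral gives equality for real r > 0; the points
  -- 1 + 1/(n+1) accumulate at 1, so the identity theorem applies.
  refine h1.eqOn_of_preconnected_of_frequently_eq h2 hconn (z₀ := 1) (by simp) ?_ hr
  have ht : Tendsto (fun n : ℕ => ((1 + 1 / ((n : ℝ) + 1) : ℝ) : ℂ)) atTop (𝓝[≠] 1) := by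
    refine tendsto_nhdsWithin_iff.mpr ⟨?_, .of_forall fun n => ?_⟩
    · have : Tendsto (fun n : ℕ => (1 + 1 / ((n : ℝ) + 1) : ℝ)) atTop (𝓝 (1 + 0)) :=
        tendsto_const_nhds.add tendsto_one_div_add_atTop_nhds_zero_nat
      have := (continuous_ofReal.tendsto _).comp this
      simpa [Function.comp_def] using this
    · have : (0 : ℝ) < 1 / ((n : ℝ) + 1) := by positivity
      simp only [mem_compl_iff, mem_singleton_iff, ofReal_eq_one]
      linarith
  refine ht.frequently (Frequently.of_forall fun n => ?_)
  have hpos : (0 : ℝ) < 1 + 1 / ((n : ℝ) + 1) := by positivity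
  rw [integral_cpow_mul_exp_neg_mul_Ioi hs hpos, one_div, inv_cpow, cpow_neg]
  rw [arg_ofReal_of_nonneg hpos.le]
  exact Real.pi_pos.ne

/-- In Euler's integral with r = exp(iθ), the factor r^(-s) has norm exp(θ Im s), whereas the
integral is at most that of t^(Re s - 1) exp(-t cos θ). -/
lemma norm_Gamma_le_exp {s : ℂ} (hs : 0 < s.re) {θ : ℝ} (hθ : θ ∈ Ioo (-(π / 2)) (π / 2)) :
    ‖Gamma s‖ ≤ (1 / Real.cos θ) ^ s.re * Real.Gamma s.re * Real.exp (-(θ * s.im)) := by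
  have hc : 0 < Real.cos θ := Real.cos_pos_of_mem_Ioo hθ
  have hre : (cexp (θ * I)).re = Real.cos θ := by
    rw [exp_mul_I]; simp [← ofReal_cos, ← ofReal_sin]
  have h := integral_cpow_mul_exp_neg_of_re_pos hs (r := cexp (θ * I)) (hre ▸ hc)
  have hn : ‖cexp (θ * I) ^ (-s)‖ = Real.exp (θ * s.im) := by
    rw [norm_cpow_of_ne_zero (exp_ne_zero _), norm_exp_ofReal_mul_I, Real.one_rpow,
      exp_mul_I, arg_cos_add_sin_mul_I ⟨by linarith [hθ.1, Real.pi_pos], by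
        linarith [hθ.2, Real.pi_pos]⟩]
    simp [← Real.exp_neg]
  have h' : ‖cexp (θ * I) ^ (-s) * Gamma s‖ ≤ (1 / Real.cos θ) ^ s.re * Real.Gamma s.re := by
    rw [← h, ← Real.integral_rpow_mul_exp_neg_mul_Ioi hs hc]
    refine (norm_integral_le_integral_norm _).trans_eq ?_
    refine setIntegral_congr_fun measurableSet_Ioi fun t ht => ?_
    simp only [norm_mul, norm_cpow_eq_rpow_re_of_pos ht, norm_exp, sub_re, one_re, neg_re,
      mul_re, hre, ofReal_re, ofReal_im, mul_zero, sub_zero]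
  rw [norm_mul, hn] at h'
  rw [Real.exp_neg, ← div_eq_mul_inv, le_div_iff₀ (Real.exp_pos _), mul_comm]
  exact h'

/-- On vertical lines `Γ` decays like `exp (-θ |Im s|)` for every `θ < π / 2`. -/
lemma exists_norm_Gamma_le_exp_neg_abs {σ : ℝ} (hσ : 0 < σ) {θ : ℝ} (h0 : 0 ≤ θ)
    (hθ : θ < π / 2) :
    ∃ C : ℝ, 0 ≤ C ∧ ∀ s : ℂ, s.re = σ → ‖Gamma s‖ ≤ C * Real.exp (-(θ * |s.im|)) := by
  have hθ' : θ ∈ Ioo (-(π / 2)) (π / 2) := ⟨by linarith, hθ⟩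
  have hθ'' : -θ ∈ Ioo (-(π / 2)) (π / 2) := ⟨by linarith, by linarith⟩
  have hc : 0 < Real.cos θ := Real.cos_pos_of_mem_Ioo hθ'
  refine ⟨(1 / Real.cos θ) ^ σ * Real.Gamma σ, ?_, ?_⟩
  · have := Real.Gamma_pos_of_pos hσ
    positivity
  · rintro s rfl
    rcases le_total 0 s.im with h | h
    · simpa [abs_of_nonneg h] using norm_Gamma_le_exp hσ hθ'
    · simpa [abs_of_nonpos h] using norm_Gamma_le_exp hσ hθ''

lemma integrable_exp_neg_mul_abs {a : ℝ} (ha : 0 < a) :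
    Integrable fun t : ℝ => Real.exp (-(a * |t|)) := by
  have h1 : IntegrableOn (fun t : ℝ => Real.exp (-(a * |t|))) (Ioi 0) := by
    refine (exp_neg_integrableOn_Ioi 0 ha).congr_fun (fun t ht => ?_) measurableSet_Ioi
    simp [abs_of_pos (show 0 < t from ht)]
  have h2 : IntegrableOn (fun t : ℝ => Real.exp (-(a * |t|))) (Iic 0) := by
    rw [← (Measure.measurePreserving_neg volume).integrableOn_comp_preimage
      (Homeomorph.neg ℝ).measurableEmbedding]
    simpa [Function.comp_def, integrableOn_Ici_iff_integrableOn_Ioi] using h1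
  rw [← integrableOn_univ, ← Iic_union_Ioi (a := (0 : ℝ))]
  exact h2.union h1

end GammaLaplace

/-! ### Mellin–Barnes representation of the individual terms. -/

section MellinBarnes

open Complex MeasureTheory Set Filter Topology

lemma mellin_exp_neg_mul_sqrt {b : ℝ} (hb : 0 < b) {v : ℂ} (hv : 0 < v.re) :
    MellinConvergent (fun x : ℝ => cexp (-(b * (x ^ (1 / 2 : ℝ) : ℝ)))) v ∧
      mellin (fun x : ℝ => cexp (-(b * (x ^ (1 / 2 : ℝ) : ℝ)))) v =
        2 * (b : ℂ) ^ (-(2 * v)) * Gamma (2 * v) := by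
  have e : v / ((1 / 2 : ℝ) : ℂ) = 2 * v := by push_cast; ring
  have hv' : 0 < (2 * v).re := by simpa using hv
  have hb' : 0 < (b : ℂ).re := by simpa using hb
  constructor
  · rw [MellinConvergent.comp_rpow (f := fun x : ℝ => cexp (-(b * x))) (by norm_num), e]
    exact integrableOn_cpow_mul_exp_neg hv' hb'
  · rw [mellin_comp_rpow (fun x : ℝ => cexp (-(b * x))), e, mellin]
    simp_rw [smul_eq_mul]
    rw [integral_cpow_mul_exp_neg_of_re_pos hv' hb', abs_of_pos (by norm_num)]
    simp only [one_div, inv_inv, real_smul, ofReal_ofNat]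
    ring

lemma continuous_Gamma_comp {f : ℝ → ℂ} (hf : Continuous f) (h : ∀ t, 0 < (f t).re) :
    Continuous fun t => Gamma (f t) := by
  refine continuous_iff_continuousAt.mpr fun t => ?_
  refine ContinuousAt.comp (f := f) (g := Gamma) ?_ hf.continuousAt
  refine (differentiableAt_Gamma _ fun k hk => ?_).continuousAt
  have := h t
  rw [hk] at this
  simp only [neg_re, natCast_re, Left.neg_pos_iff] at this
  exact absurd this (not_lt.mpr k.cast_nonneg)

lemma integrable_mellin_exp_neg_mul_sqrt {b σ : ℝ} (hb : 0 < b) (hσ : 0 < σ) :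
    Integrable fun τ : ℝ =>
      2 * (b : ℂ) ^ (-(2 * (σ + τ * I))) * Gamma (2 * (σ + τ * I)) := by
  obtain ⟨C, hC, h⟩ := exists_norm_Gamma_le_exp_neg_abs (σ := 2 * σ) (by linarith)
    (θ := π / 3) (by positivity) (by linarith [Real.pi_pos])
  refine Integrable.mono' ((integrable_exp_neg_mul_abs (a := 2 * π / 3)
    (by positivity)).const_mul (2 * b ^ (-(2 * σ)) * C)) ?_ (.of_forall fun τ => ?_)
  · refine Continuous.aestronglyMeasurable (Continuous.mul (Continuous.mul (by fun_prop) ?_) ?_)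
    · exact Continuous.const_cpow (by fun_prop) (Or.inl (by exact_mod_cast hb.ne'))
    · exact continuous_Gamma_comp (by fun_prop) (by simp [hσ])
  · have := h (2 * (σ + τ * I)) (by simp)
    rw [norm_mul, norm_mul, norm_cpow_eq_rpow_re_of_pos hb, mul_assoc (2 * _) C]
    have e : C * Real.exp (-(π / 3 * |(2 * ((σ : ℂ) + τ * I)).im|)) =
        C * Real.exp (-(2 * π / 3 * |τ|)) := by
      simp [abs_mul]; left; ring
    rw [e] at this
    have e2 : (-(2 * ((σ : ℂ) + τ * I))).re = -(2 * σ) := by simp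
    rw [e2]
    simp only [norm_ofNat]
    gcongr

/-- Mellin inversion; the vertical integrability it needs is the exponential decay of Γ(2v). -/
lemma exp_neg_mul_sqrt_eq_integral {b σ x : ℝ} (hb : 0 < b) (hσ : 0 < σ) (hx : 0 < x) :
    cexp (-(b * (√x : ℝ))) = 1 / (2 * π) * ∫ τ : ℝ, (x : ℂ) ^ (-(σ + τ * I)) *
      (2 * (b : ℂ) ^ (-(2 * (σ + τ * I))) * Gamma (2 * (σ + τ * I))) := by
  have hre : ∀ τ : ℝ, 0 < ((σ : ℂ) + τ * I).re := fun τ => by simpa using hσ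
  have h := mellinInv_mellin_eq σ (fun x : ℝ => cexp (-(b * (x ^ (1 / 2 : ℝ) : ℝ)))) hx
    (by simpa using (mellin_exp_neg_mul_sqrt hb (v := σ) (by simpa using hσ)).1)
    ?_ ?_
  · rw [Real.sqrt_eq_rpow, ← h, mellinInv]
    rw [real_smul]
    simp_rw [fun τ : ℝ => (mellin_exp_neg_mul_sqrt hb (hre τ)).2, smul_eq_mul]
    push_cast
    rfl
  · rw [VerticalIntegrable]
    simp_rw [fun τ : ℝ => (mellin_exp_neg_mul_sqrt hb (hre τ)).2]
    exact integrable_mellin_exp_neg_mul_sqrt hb hσ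
  · have : ContinuousAt (fun x : ℝ => x ^ (1 / 2 : ℝ)) x :=
      Real.continuousAt_rpow_const _ _ (Or.inl hx.ne')
    fun_prop

/-- The Mellin transform of `exp (-b √x)` at `v` times that of `exp (-r x)` at `m + 1 - v`. -/
noncomputable def mellinKernel (m : ℕ) (b : ℝ) (r v : ℂ) : ℂ :=
  2 * (b : ℂ) ^ (-(2 * v)) * Gamma (2 * v) * (r ^ (-(m + 1 - v)) * Gamma (m + 1 - v))

/-- Insert the inversion integral for exp(-b√x) and apply Fubini. The hypothesis Re r > 0 makes the
double integral absolutely convergent. -/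
lemma integral_pow_mul_exp_mul_exp_sqrt_of_re_pos (m : ℕ) {b σ : ℝ} (hb : 0 < b) (hσ : 0 < σ)
    (hσm : σ < m + 1) {r : ℂ} (hr : 0 < r.re) :
    ∫ x : ℝ in Ioi 0, (x : ℂ) ^ m * cexp (-(r * x)) * cexp (-(b * (√x : ℝ))) =
      1 / (2 * π) * ∫ τ : ℝ, mellinKernel m b r (σ + τ * I) := by
  set F : ℝ → ℝ → ℂ := fun x τ => (x : ℂ) ^ ((m + 1 - (σ + τ * I)) - 1) * cexp (-(r * x)) *
    (2 * (b : ℂ) ^ (-(2 * (σ + τ * I))) * Gamma (2 * (σ + τ * I))) with hF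
  have hw : ∀ τ : ℝ, 0 < ((m : ℂ) + 1 - (σ + τ * I)).re := fun τ => by simpa using hσm
  have hI := integrable_mellin_exp_neg_mul_sqrt hb hσ
  -- For x > 0 the norm of a power of x sees only the real part of the exponent, so the norm of F is
  -- a function of x times a function of τ.
  have hint : Integrable (Function.uncurry F) ((volume.restrict (Ioi 0)).prod volume) := by
    have h1 := (integrableOn_cpow_mul_exp_neg (s := m + 1 - σ) (by simpa using hσm) hr).norm
    refine Integrable.mono' (h1.mul_prod hI.norm) ?_ ?_
    · have := hI.aestronglyMeasurable.comp_snd (μ := volume.restrict (Ioi (0 : ℝ)))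
      refine AEStronglyMeasurable.mul ?_ this
      refine Measurable.aestronglyMeasurable ?_
      fun_prop
    · have : ∀ᵐ p : ℝ × ℝ ∂(volume.restrict (Ioi 0)).prod volume, p.1 ∈ Ioi (0 : ℝ) :=
        Measure.quasiMeasurePreserving_fst.ae (self_mem_ae_restrict measurableSet_Ioi)
      filter_upwards [this] with p hp
      simp only [hF, Function.uncurry, norm_mul, norm_cpow_eq_rpow_re_of_pos hp]
      simp
  have hswap := integral_integral_swap hint
  have hL : ∀ x ∈ Ioi (0 : ℝ), (x : ℂ) ^ m * cexp (-(r * x)) * cexp (-(b * (√x : ℝ))) =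
      1 / (2 * π) * ∫ τ : ℝ, F x τ := by
    intro x hx
    have hx0 : (x : ℂ) ≠ 0 := by exact_mod_cast (ne_of_gt hx)
    rw [exp_neg_mul_sqrt_eq_integral hb hσ hx, mul_left_comm, ← integral_const_mul]
    congr 2
    ext τ
    have : (x : ℂ) ^ (((m : ℂ) + 1 - (σ + τ * I)) - 1) = x ^ m * (x : ℂ) ^ (-(σ + τ * I)) := by
      rw [← cpow_natCast, ← cpow_add _ _ hx0]; congr 1; ring
    simp only [hF, this]
    ring
  rw [setIntegral_congr_fun measurableSet_Ioi hL, integral_const_mul, hswap]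
  congr 2
  ext τ
  simp only [hF, mellinKernel]
  rw [integral_mul_const, integral_cpow_mul_exp_neg_of_re_pos (hw τ) hr]
  ring

/-- Since |arg r| ≤ π/2, the power of r costs at most exp(π|τ|/2). The factor Γ(2v) gains
exp(-2θ|τ|), so any θ in (π/4, π/2) suffices; θ = π/3 leaves exp(-π|τ|/6). Of Γ(m+1-v) only
boundedness is used. Uniformity in r serves the passage to the imaginary axis. -/
lemma exists_norm_mellinKernel_le (m : ℕ) {b σ A : ℝ} (hb : 0 < b) (hσ : 0 < σ)
    (hσm : σ < m + 1) (hA : 0 < A) :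
    ∃ C : ℝ, ∀ (r : ℂ) (τ : ℝ), 0 ≤ r.re → A ≤ ‖r‖ →
      ‖mellinKernel m b r (σ + τ * I)‖ ≤ C * Real.exp (-(π / 6 * |τ|)) := by
  obtain ⟨C, hC, h⟩ := exists_norm_Gamma_le_exp_neg_abs (σ := 2 * σ) (by linarith)
    (θ := π / 3) (by positivity) (by linarith [Real.pi_pos])
  obtain ⟨D, hD, h'⟩ := exists_norm_Gamma_le_exp_neg_abs (σ := m + 1 - σ) (by linarith)
    (θ := 0) le_rfl (by positivity)
  refine ⟨2 * b ^ (-(2 * σ)) * C * (A ^ (-(m + 1 - σ)) * D), fun r τ hr hAr => ?_⟩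
  have hr0 : r ≠ 0 := norm_pos_iff.mp (hA.trans_le hAr)
  have h1 := h (2 * (σ + τ * I)) (by simp)
  have h2 := h' (m + 1 - (σ + τ * I)) (by simp)
  have e1 : (2 * ((σ : ℂ) + τ * I)).im = 2 * τ := by simp
  have e2 : (-(2 * ((σ : ℂ) + τ * I))).re = -(2 * σ) := by simp
  have e3 : (-((m : ℂ) + 1 - (σ + τ * I))).re = -(m + 1 - σ) := by simp
  have e4 : (-((m : ℂ) + 1 - (σ + τ * I))).im = τ := by simp
  have h3 : ‖r ^ (-((m : ℂ) + 1 - (σ + τ * I)))‖ ≤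
      A ^ (-(m + 1 - σ)) * Real.exp (π / 2 * |τ|) := by
    rw [norm_cpow_of_ne_zero hr0, e3, e4, div_eq_mul_inv, ← Real.exp_neg]
    have harg := abs_arg_le_pi_div_two_iff.mpr hr
    refine mul_le_mul (Real.rpow_le_rpow_of_nonpos hA hAr (by linarith)) ?_ (by positivity)
      (by positivity)
    refine Real.exp_le_exp.mpr ((neg_le_abs _).trans ?_)
    rw [abs_mul]
    gcongr
  rw [e1, abs_mul, abs_two] at h1
  simp only [zero_mul, neg_zero, Real.exp_zero, mul_one] at h2
  rw [mellinKernel, norm_mul, norm_mul, norm_mul, norm_mul, norm_cpow_eq_rpow_re_of_pos hb, e2,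
    norm_ofNat]
  have e5 : Real.exp (-(π / 6 * |τ|)) =
      Real.exp (-(π / 3 * (2 * |τ|))) * Real.exp (π / 2 * |τ|) := by
    rw [← Real.exp_add]; congr 1; ring
  calc _ ≤ 2 * b ^ (-(2 * σ)) * (C * Real.exp (-(π / 3 * (2 * |τ|)))) *
        (A ^ (-(m + 1 - σ)) * Real.exp (π / 2 * |τ|) * D) := by gcongr
    _ = _ := by rw [e5]; ring

lemma continuous_mellinKernel (m : ℕ) {b σ : ℝ} (hb : 0 < b) (hσ : 0 < σ)
    (hσm : σ < m + 1) {r : ℂ} (hr : r ≠ 0) :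
    Continuous fun τ : ℝ => mellinKernel m b r (σ + τ * I) := by
  unfold mellinKernel
  refine ((continuous_const.mul ?_).mul ?_).mul (Continuous.mul ?_ ?_)
  · exact Continuous.const_cpow (by fun_prop) (Or.inl (by exact_mod_cast hb.ne'))
  · exact continuous_Gamma_comp (by fun_prop) (by simp [hσ])
  · exact Continuous.const_cpow (by fun_prop) (Or.inl hr)
  · exact continuous_Gamma_comp (by fun_prop) (by simp [hσm])

lemma integrable_mellinKernel (m : ℕ) {b σ : ℝ} (hb : 0 < b) (hσ : 0 < σ)
    (hσm : σ < m + 1) {r : ℂ} (hr : 0 ≤ r.re) (hr0 : r ≠ 0) :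
    Integrable fun τ : ℝ => mellinKernel m b r (σ + τ * I) := by
  obtain ⟨C, hC⟩ := exists_norm_mellinKernel_le m hb hσ hσm (norm_pos_iff.mpr hr0)
  exact ((integrable_exp_neg_mul_abs (by positivity)).const_mul C).mono'
    (continuous_mellinKernel m hb hσ hσm hr0).aestronglyMeasurable
    (.of_forall fun τ => hC r τ hr le_rfl)

lemma integrableOn_pow_mul_exp_neg_mul_sqrt (m : ℕ) {b : ℝ} (hb : 0 < b) :
    IntegrableOn (fun x : ℝ => x ^ m * Real.exp (-(b * √x))) (Ioi 0) := by
  have := integrableOn_rpow_mul_exp_neg_mul_rpow (p := 1 / 2) (s := m) (b := b)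
    (by linarith [m.cast_nonneg (α := ℝ)]) (by norm_num) hb
  simpa [Real.sqrt_eq_rpow] using this

/-- For Re r = 0, where Fubini is not available, replace r by r + ε and let ε ↓ 0. Dominated
convergence holds on the left with x^m exp(-b√x), and on the right with the uniform kernel bound. -/
lemma integral_pow_mul_exp_mul_exp_sqrt (m : ℕ) {b σ : ℝ} (hb : 0 < b) (hσ : 0 < σ)
    (hσm : σ < m + 1) {r : ℂ} (hr : 0 ≤ r.re) (hr0 : r ≠ 0) :
    ∫ x : ℝ in Ioi 0, (x : ℂ) ^ m * cexp (-(r * x)) * cexp (-(b * (√x : ℝ))) =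
      1 / (2 * π) * ∫ τ : ℝ, mellinKernel m b r (σ + τ * I) := by
  have hcont : Tendsto (fun ε : ℝ => r + ε) (𝓝[>] 0) (𝓝 r) := by
    have : Continuous fun ε : ℝ => r + ε := by fun_prop
    simpa using (this.tendsto 0).mono_left nhdsWithin_le_nhds
  have hpos : ∀ᶠ ε : ℝ in 𝓝[>] 0, 0 < (r + ε).re := by
    filter_upwards [self_mem_nhdsWithin] with ε hε
    have : 0 < ε := hε
    simp only [add_re, ofReal_re]
    linarith
  have hl : Tendsto (fun ε : ℝ => ∫ x : ℝ in Ioi 0, (x : ℂ) ^ m * cexp (-((r + ε) * x)) *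
      cexp (-(b * (√x : ℝ)))) (𝓝[>] 0)
      (𝓝 (∫ x : ℝ in Ioi 0, (x : ℂ) ^ m * cexp (-(r * x)) * cexp (-(b * (√x : ℝ))))) := by
    refine tendsto_integral_filter_of_dominated_convergence
      (fun x => x ^ m * Real.exp (-(b * √x))) ?_ ?_ (integrableOn_pow_mul_exp_neg_mul_sqrt m hb) ?_
    · exact .of_forall fun ε => Continuous.aestronglyMeasurable (by fun_prop)
    · filter_upwards [hpos] with ε hε
      filter_upwards [self_mem_ae_restrict measurableSet_Ioi] with x hx
      have hx : 0 < x := hx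
      rw [norm_mul, norm_mul, norm_pow, norm_exp, norm_exp, norm_real, Real.norm_of_nonneg hx.le]
      have : (-(b * (√x : ℝ)) : ℂ).re = -(b * √x) := by simp
      rw [this]
      refine mul_le_mul_of_nonneg_right ?_ (by positivity)
      refine mul_le_of_le_one_right (by positivity) (Real.exp_le_one_iff.mpr ?_)
      rw [neg_re, re_mul_ofReal]
      nlinarith
    · refine .of_forall fun x => ?_
      have : Continuous fun z : ℂ => (x : ℂ) ^ m * cexp (-(z * x)) * cexp (-(b * (√x : ℝ))) := by
        fun_prop
      exact (this.tendsto r).comp hcont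
  have hrt : Tendsto (fun ε : ℝ => ∫ τ : ℝ, mellinKernel m b (r + ε) (σ + τ * I)) (𝓝[>] 0)
      (𝓝 (∫ τ : ℝ, mellinKernel m b r (σ + τ * I))) := by
    have hA : 0 < ‖r‖ / 2 := by have := norm_pos_iff.mpr hr0; positivity
    obtain ⟨C, hC⟩ := exists_norm_mellinKernel_le m hb hσ hσm hA
    -- The kernel bound requires r + ε to stay away from 0.
    have hnorm : ∀ᶠ ε : ℝ in 𝓝[>] 0, ‖r‖ / 2 < ‖r + ε‖ :=
      hcont.norm.eventually_const_lt (by linarith)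
    refine tendsto_integral_filter_of_dominated_convergence _ ?_ ?_
      ((integrable_exp_neg_mul_abs (a := π / 6) (by positivity)).const_mul C) ?_
    · filter_upwards [hnorm] with ε hε
      exact (continuous_mellinKernel m hb hσ hσm
        (norm_pos_iff.mp (hA.trans hε))).aestronglyMeasurable
    · filter_upwards [hnorm, hpos] with ε hε hε'
      exact .of_forall fun τ => hC _ _ hε'.le hε.le
    · refine .of_forall fun τ => ?_
      unfold mellinKernel
      refine Tendsto.const_mul _ (Tendsto.mul_const _ ?_)
      refine (ContinuousAt.tendsto (f := fun z : ℂ => z ^ (-((m : ℂ) + 1 - (σ + τ * I)))) ?_).comp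
        hcont
      refine continuousAt_cpow_const ?_
      rw [mem_slitPlane_iff]
      by_contra! h
      exact hr0 (Complex.ext (le_antisymm h.1 hr) h.2)
  refine tendsto_nhds_unique (hl.congr' ?_) (hrt.const_mul _)
  filter_upwards [hpos] with ε hε
  exact integral_pow_mul_exp_mul_exp_sqrt_of_re_pos m hb hσ hσm hε

/-- `mellinKernel` averaged over `r = ± i A`. -/
noncomputable def cosKernel (m : ℕ) (b A : ℝ) (v : ℂ) : ℂ :=
  2 * (b : ℂ) ^ (-(2 * v)) * Gamma (2 * v) *
    ((A : ℂ) ^ (-(m + 1 - v)) * Gamma (m + 1 - v) * Complex.cos (π * (m + 1 - v) / 2))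

/-- With principal powers (±i)^(-w) = exp(∓iπw/2), and the average of the two is cos(πw/2); here w =
m + 1 - v. -/
lemma cosKernel_eq (m : ℕ) (b : ℝ) {A : ℝ} (hA : 0 < A) (v : ℂ) :
    cosKernel m b A v = (mellinKernel m b (A * I) v + mellinKernel m b (A * -I) v) / 2 := by
  have hA0 : (A : ℂ) ≠ 0 := by exact_mod_cast hA.ne'
  have h : ∀ J : ℂ, J ≠ 0 → ∀ w : ℂ, ((A : ℂ) * J) ^ w = (A : ℂ) ^ w * J ^ w := by
    intro J hJ w
    rw [cpow_def_of_ne_zero (mul_ne_zero hA0 hJ), cpow_def_of_ne_zero hA0,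
      cpow_def_of_ne_zero hJ, log_ofReal_mul hA hJ, ofReal_log hA.le, ← exp_add]
    ring_nf
  have hI : (-I : ℂ) ≠ 0 := neg_ne_zero.mpr I_ne_zero
  rw [cosKernel, mellinKernel, mellinKernel, h _ I_ne_zero, h _ hI, cpow_def_of_ne_zero I_ne_zero,
    cpow_def_of_ne_zero hI, log_I, log_neg_I, Complex.cos]
  have e1 : (π : ℂ) / 2 * I * -(m + 1 - v) = -(π * (m + 1 - v) / 2) * I := by ring
  have e2 : -((π : ℂ) / 2) * I * -(m + 1 - v) = (π * (m + 1 - v) / 2) * I := by ring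
  rw [e1, e2]
  ring

lemma integrable_cosKernel (m : ℕ) {b σ A : ℝ} (hb : 0 < b) (hA : 0 < A) (hσ : 0 < σ)
    (hσm : σ < m + 1) : Integrable fun τ : ℝ => cosKernel m b A (σ + τ * I) := by
  have hA0 : (A : ℂ) ≠ 0 := by exact_mod_cast hA.ne'
  simp_rw [cosKernel_eq m b hA]
  exact ((integrable_mellinKernel m hb hσ hσm (by simp) (by simp [hA0])).add
    (integrable_mellinKernel m hb hσ hσm (by simp) (by simp [hA0]))).div_const 2

/-- Mellin–Barnes representation of the terms of Ramanujan's integral. -/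
lemma integral_cosKernel (m : ℕ) {b σ A : ℝ} (hb : 0 < b) (hA : 0 < A) (hσ : 0 < σ)
    (hσm : σ < m + 1) :
    ∫ τ : ℝ, cosKernel m b A (σ + τ * I) =
      2 * π * ((∫ x in Ioi (0 : ℝ), x ^ m * Real.cos (A * x) * Real.exp (-(b * √x)) : ℝ) : ℂ) := by
  have hA0 : (A : ℂ) ≠ 0 := by exact_mod_cast hA.ne'
  have hpi : (π : ℂ) ≠ 0 := by exact_mod_cast Real.pi_ne_zero
  have h1 := integral_pow_mul_exp_mul_exp_sqrt m hb hσ hσm (r := A * I) (by simp) (by simp [hA0])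
  have h2 := integral_pow_mul_exp_mul_exp_sqrt m hb hσ hσm (r := A * -I) (by simp) (by simp [hA0])
  simp_rw [cosKernel_eq m b hA]
  rw [integral_div, integral_add
    (integrable_mellinKernel m hb hσ hσm (by simp) (by simp [hA0]))
    (integrable_mellinKernel m hb hσ hσm (by simp) (by simp [hA0]))]
  have hint : ∀ J : ℂ, J.re = 0 → IntegrableOn (fun x : ℝ => (x : ℂ) ^ m *
      cexp (-(A * J * x)) * cexp (-(b * (√x : ℝ)))) (Ioi 0) := by
    intro J hJ
    refine (integrableOn_pow_mul_exp_neg_mul_sqrt m hb).mono'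
      (Continuous.aestronglyMeasurable (by fun_prop)) ?_
    filter_upwards [self_mem_ae_restrict measurableSet_Ioi] with x hx
    have hx : 0 < x := hx
    simp [norm_exp, hJ, abs_of_pos hx]
  have h3 : ((∫ x in Ioi (0 : ℝ), x ^ m * Real.cos (A * x) * Real.exp (-(b * √x)) : ℝ) : ℂ) =
      ((∫ x : ℝ in Ioi 0, (x : ℂ) ^ m * cexp (-(A * I * x)) * cexp (-(b * (√x : ℝ)))) +
        ∫ x : ℝ in Ioi 0, (x : ℂ) ^ m * cexp (-(A * -I * x)) * cexp (-(b * (√x : ℝ)))) / 2 := by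
    rw [← integral_add (hint I (by simp)) (hint (-I) (by simp)), ← integral_div,
      ← integral_complex_ofReal]
    congr 1
    ext x
    push_cast
    rw [Complex.cos]
    ring_nf
  rw [h3, h1, h2]
  field_simp

end MellinBarnes

/-! ### Gamma product formulas and the identification with Meijer functions. -/

section MeijerG

open Complex MeasureTheory Set

/-- Gauss' multiplication formula for `4`. -/
lemma Gamma_quadruplication (s : ℂ) :
    Gamma s * Gamma (s + 1 / 4) * Gamma (s + 2 / 4) * Gamma (s + 3 / 4) =
      Gamma (4 * s) * (2 : ℂ) ^ (5 / 2 - 8 * s) * (√π : ℝ) ^ 3 := by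
  have h1 := Gamma_mul_Gamma_add_half s
  have h2 := Gamma_mul_Gamma_add_half (s + 1 / 4)
  have h3 := Gamma_mul_Gamma_add_half (2 * s)
  rw [show s + 1 / 4 + 1 / 2 = s + 3 / 4 by ring, show 2 * (s + 1 / 4) = 2 * s + 1 / 2 by ring]
    at h2
  rw [show 2 * (2 * s) = 4 * s by ring] at h3
  have h2ne : (2 : ℂ) ≠ 0 := two_ne_zero
  have e : (2 : ℂ) ^ (5 / 2 - 8 * s) =
      2 ^ (1 - 2 * s) * 2 ^ (1 - (2 * s + 1 / 2)) * 2 ^ (1 - 4 * s) := by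
    rw [← cpow_add _ _ h2ne, ← cpow_add _ _ h2ne]
    congr 1; ring
  rw [show s + 2 / 4 = s + 1 / 2 by ring, e]
  calc _ = (Gamma s * Gamma (s + 1 / 2)) * (Gamma (s + 1 / 4) * Gamma (s + 3 / 4)) := by ring
    _ = (Gamma (2 * s) * Gamma (2 * s + 1 / 2)) * (2 ^ (1 - 2 * s) *
        2 ^ (1 - (2 * s + 1 / 2)) * (√π : ℝ) ^ 2) := by rw [h1, h2]; ring
    _ = _ := by rw [h3]; ring

/-- Gauss' multiplication formula for `8`. -/
lemma Gamma_octuplication (s : ℂ) :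
    (Gamma s * Gamma (s + 1 / 8) * Gamma (s + 2 / 8) * Gamma (s + 3 / 8)) *
      (Gamma (s + 4 / 8) * Gamma (s + 5 / 8) * Gamma (s + 6 / 8) * Gamma (s + 7 / 8)) =
      Gamma (8 * s) * (2 : ℂ) ^ (5 - 24 * s) * (√π : ℝ) ^ 7 := by
  have h1 := Gamma_quadruplication s
  have h2 := Gamma_quadruplication (s + 1 / 8)
  have h3 := Gamma_mul_Gamma_add_half (4 * s)
  rw [show s + 1 / 8 + 1 / 4 = s + 3 / 8 by ring, show s + 1 / 8 + 2 / 4 = s + 5 / 8 by ring,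
    show s + 1 / 8 + 3 / 4 = s + 7 / 8 by ring, show 4 * (s + 1 / 8) = 4 * s + 1 / 2 by ring]
    at h2
  rw [show 2 * (4 * s) = 8 * s by ring] at h3
  have h2ne : (2 : ℂ) ≠ 0 := two_ne_zero
  have e : (2 : ℂ) ^ (5 - 24 * s) =
      2 ^ (5 / 2 - 8 * s) * 2 ^ (5 / 2 - 8 * (s + 1 / 8)) * 2 ^ (1 - 8 * s) := by
    rw [← cpow_add _ _ h2ne, ← cpow_add _ _ h2ne]
    congr 1; ring
  rw [show s + 2 / 8 = s + 1 / 4 by ring, show s + 4 / 8 = s + 2 / 4 by ring,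
    show s + 6 / 8 = s + 3 / 4 by ring, e]
  calc _ = (Gamma s * Gamma (s + 1 / 4) * Gamma (s + 2 / 4) * Gamma (s + 3 / 4)) *
        (Gamma (s + 1 / 8) * Gamma (s + 3 / 8) * Gamma (s + 5 / 8) * Gamma (s + 7 / 8)) := by ring
    _ = (Gamma (4 * s) * Gamma (4 * s + 1 / 2)) * (2 ^ (5 / 2 - 8 * s) *
        2 ^ (5 / 2 - 8 * (s + 1 / 8)) * (√π : ℝ) ^ 6) := by rw [h1, h2]; ring
    _ = _ := by rw [h3]; ring

/-- Duplication at -u replaces Γ(-u) by a multiple of Γ(-2u)/Γ(1/2 - u), and reflection gives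
1/(Γ(1/2 - u) Γ(1/2 + u)) = cos(πu)/π. -/
lemma Gamma_neg_div_Gamma_half_add {u : ℂ} (hu : u.re < 0) :
    Gamma (-u) / Gamma (1 / 2 + u) =
      Gamma (-(2 * u)) * (2 : ℂ) ^ (1 + 2 * u) * Complex.cos (π * u) / (√π : ℝ) := by
  have h1 := Gamma_mul_Gamma_add_half (-u)
  rw [show -u + 1 / 2 = 1 / 2 - u by ring, show 2 * -u = -(2 * u) by ring, sub_neg_eq_add] at h1
  have h2 := Gamma_mul_Gamma_one_sub (1 / 2 + u)
  rw [show 1 - (1 / 2 + u) = 1 / 2 - u by ring,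
    show (π : ℂ) * (1 / 2 + u) = π * u + π / 2 by ring, Complex.sin_add_pi_div_two] at h2
  have hne : Gamma (1 / 2 - u) ≠ 0 := by
    refine Gamma_ne_zero_of_re_pos ?_
    simp only [sub_re, one_div, inv_re, re_ofNat, normSq_ofNat]
    norm_num
    linarith
  have hpi : (π : ℂ) ≠ 0 := by exact_mod_cast Real.pi_ne_zero
  have hs : ((√π : ℝ) : ℂ) ≠ 0 := by
    exact_mod_cast (Real.sqrt_pos.mpr Real.pi_pos).ne'
  have hss : ((√π : ℝ) : ℂ) * (√π : ℝ) = π := by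
    exact_mod_cast Real.mul_self_sqrt Real.pi_pos.le
  -- If the cosine vanishes, 1/2 + u is a pole of Γ, where `Gamma` takes the value 0; division by
  -- zero then makes the left side 0 as well.
  rcases eq_or_ne (Complex.cos (π * u)) 0 with hc | hc
  · rw [hc, div_zero] at h2
    rw [hc, (mul_eq_zero.mp h2).resolve_right hne]
    simp
  · have hG : Gamma (1 / 2 + u) ≠ 0 := fun h => by
      rw [h, zero_mul] at h2
      exact div_ne_zero hpi hc h2.symm
    rw [div_eq_div_iff hG hs]
    refine mul_right_cancel₀ hne ?_
    calc _ = Gamma (-u) * Gamma (1 / 2 - u) * (√π : ℝ) := by ring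
      _ = Gamma (-(2 * u)) * 2 ^ (1 + 2 * u) * Complex.cos (π * u) * (π / Complex.cos (π * u)) := by
        have hcc : Complex.cos (π * u) * (π / Complex.cos (π * u)) = π := by field_simp
        rw [h1]
        linear_combination Gamma (-(2 * u)) * 2 ^ (1 + 2 * u) * (hss - hcc)
      _ = _ := by rw [← h2]; ring

/-- The integral `∫ x ^ m cos (A x) exp (-b √x)` over the positive half-line. -/
noncomputable def cosSqrtIntegral (m : ℕ) (A b : ℝ) : ℝ :=
  ∫ x in Ioi (0 : ℝ), x ^ m * Real.cos (A * x) * Real.exp (-(b * √x))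

/-- A Meijer function whose integrand is a rescaled `cosKernel`. -/
lemma meijerG_of_integrand_eq_cosKernel {N N' M M' : ℕ} {a : Fin N → ℂ} {a' : Fin N' → ℂ}
    {d : Fin M → ℂ} {d' : Fin M' → ℂ} {z K : ℂ} {m : ℕ} {A b q β : ℝ}
    (hA : 0 < A) (hb : 0 < b) (hq : 0 < q)
    (hsep : ∀ c, MeijerGSeparates a d c ↔ 0 < m + 1 + q * (c - β) ∧ c < β)
    (heq : ∀ ζ : ℂ, ζ.re < β →
      meijerGIntegrand a a' d d' z ζ = K * cosKernel m b A (m + 1 + q * (ζ - β))) :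
    MeijerGConverges a a' d d' z ∧ meijerG a a' d d' z = K / q * cosSqrtIntegral m A b := by
  have hq0 : (q : ℂ) ≠ 0 := by exact_mod_cast hq.ne'
  have hpi : (π : ℂ) ≠ 0 := by exact_mod_cast Real.pi_ne_zero
  have key : ∀ c : ℝ, MeijerGSeparates a d c →
      Integrable (fun t : ℝ => meijerGIntegrand a a' d d' z (c + t * I)) ∧
        meijerGLineIntegral a a' d d' z c = K / q * cosSqrtIntegral m A b := by
    intro c hc
    obtain ⟨h1, h2⟩ := (hsep c).mp hc
    -- The line Re ζ = c is mapped to Re v = m + 1 + q(c - β), and separation says precisely that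
    -- this lies in (0, m + 1). The change of variable produces the factor 1/q.
    have hσm : m + 1 + q * (c - β) < m + 1 := by nlinarith
    have e : (fun t : ℝ => meijerGIntegrand a a' d d' z (c + t * I)) =
        fun t : ℝ => K * cosKernel m b A ((m + 1 + q * (c - β) : ℝ) + (q * t : ℝ) * I) := by
      ext t
      rw [heq _ (by simpa using h2)]
      congr 2
      push_cast
      ring
    constructor
    · rw [e]
      exact ((integrable_cosKernel m hb hA h1 hσm).comp_mul_left' hq.ne').const_mul K
    · rw [meijerGLineIntegral, integral_mul_const, e, integral_const_mul,
        Measure.integral_comp_mul_left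
          (fun t : ℝ => cosKernel m b A ((m + 1 + q * (c - β) : ℝ) + t * I)),
        integral_cosKernel m hb hA h1 hσm, abs_of_pos (inv_pos.mpr hq), real_smul,
        ← cosSqrtIntegral]
      push_cast
      field_simp [I_ne_zero]
  have hex : ∃ c : ℝ, MeijerGSeparates a d c := by
    -- The midpoint of the separating strip β - (m+1)/q < c < β.
    refine ⟨β - (m + 1) / (2 * q), (hsep _).mpr ⟨?_, ?_⟩⟩
    · field_simp
      ring_nf
      positivity
    · have : 0 < (m + 1) / (2 * q) := by positivity
      linarith
  have hG : meijerG a a' d d' z = K / q * cosSqrtIntegral m A b := by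
    rw [meijerG, dif_pos hex]
    exact (key _ hex.choose_spec).2
  exact ⟨⟨hex, fun c hc => ⟨(key c hc).1, (key c hc).2.trans hG.symm⟩⟩, hG⟩

/-- With u = ζ - β and s = (m+1)/2 + u, the upper factors are Γ(s + j/4), whose product yields Γ(4s)
= Γ(2v) for v = m + 1 + 2u. The lower ones give Γ(-2u) cos(πu). The shift β survives only as the
factor z^β. The permutation `e` allows the upper parameters to be listed in any order. -/
lemma meijerG_one_four_eq {a : Fin 4 → ℂ} {d d' : Fin 1 → ℂ} {z : ℂ} {m : ℕ} {A b β : ℝ}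
    (hA : 0 < A) (hb : 0 < b) (e : Equiv.Perm (Fin 4))
    (ha : ∀ j, a (e j) = ((β + (2 - 2 * m - (j : ℕ)) / 4 : ℝ) : ℂ))
    (hd : d 0 = β) (hd' : d' 0 = β + 1 / 2) (hz : z = ((64 * A ^ 2 / b ^ 4 : ℝ) : ℂ)) :
    MeijerGConverges a ![] d d' z ∧ meijerG a ![] d d' z =
      (((64 * A ^ 2 / b ^ 4) ^ β * (π * 2 ^ (-(4 * (m : ℝ) + 5 / 2)) * b ^ (2 * m + 2)) *
        cosSqrtIntegral m A b : ℝ) : ℂ) := by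
  have hZ : 0 < 64 * A ^ 2 / b ^ 4 := by positivity
  have hss : ((√π : ℝ) : ℂ) * (√π : ℝ) = π := by
    exact_mod_cast Real.mul_self_sqrt Real.pi_pos.le
  have hs : ((√π : ℝ) : ℂ) ≠ 0 := by
    exact_mod_cast (Real.sqrt_pos.mpr Real.pi_pos).ne'
  have hb0 : (b : ℂ) ≠ 0 := by exact_mod_cast hb.ne'
  have hA0 : (A : ℂ) ≠ 0 := by exact_mod_cast hA.ne'
  have hlog : Complex.log ((64 * A ^ 2 / b ^ 4 : ℝ) : ℂ) =
      6 * Complex.log 2 + 2 * Complex.log A - 4 * Complex.log b := by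
    have h2 : Complex.log 2 = (Real.log 2 : ℝ) := by rw [ofReal_log zero_le_two, ofReal_ofNat]
    rw [← ofReal_log hZ.le, ← ofReal_log hA.le, ← ofReal_log hb.le, h2, Real.log_div (by positivity) (by positivity),
      Real.log_mul (by norm_num) (by positivity), show (64 : ℝ) = 2 ^ 6 by norm_num]
    simp only [Real.log_pow]
    push_cast
    ring
  have hZ0 : ((64 * A ^ 2 / b ^ 4 : ℝ) : ℂ) ≠ 0 := by exact_mod_cast hZ.ne'
  have h := meijerG_of_integrand_eq_cosKernel (a := a) (a' := ![]) (d := d) (d' := d') (z := z)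
    (K := (((64 * A ^ 2 / b ^ 4 : ℝ) : ℂ)) ^ (β : ℂ) *
      (π * (2 : ℂ) ^ (-(4 * (m : ℂ) + 3 / 2)) * (b : ℂ) ^ (2 * m + 2)))
    (m := m) (q := 2) (β := β) hA hb two_pos ?_ ?_
  · refine ⟨h.1, h.2.trans ?_⟩
    have e1 : (2 : ℂ) ^ (-(4 * (m : ℂ) + 3 / 2)) / 2 = (2 : ℂ) ^ (-(4 * (m : ℂ) + 5 / 2)) := by
      rw [show -(4 * (m : ℂ) + 5 / 2) = -(4 * (m : ℂ) + 3 / 2) - 1 by ring,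
        cpow_sub _ _ two_ne_zero, cpow_one]
    rw [ofReal_mul, ofReal_mul, ofReal_mul, ofReal_mul, ofReal_cpow hZ.le, ofReal_cpow zero_le_two]
    push_cast
    rw [← e1]
    ring
  · intro c
    rw [MeijerGSeparates]
    constructor
    -- The poles closest to the line are β on the right and, from j = 0, β - (m+1)/2 on the left.
    · rintro ⟨h1, h2⟩
      have h1 := h1 0 0
      have h2 := h2 (e 0) 0
      rw [hd] at h1
      rw [ha] at h2
      simp only [sub_re, ofReal_re] at h2
      simp at h1 h2
      exact ⟨by linarith, h1⟩
    · rintro ⟨h1, h2⟩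
      refine ⟨fun j l => ?_, fun j l => ?_⟩
      · rw [Subsingleton.elim j 0, hd]
        simp only [add_re, ofReal_re, natCast_re]
        linarith [l.cast_nonneg (α := ℝ)]
      · obtain ⟨i, rfl⟩ := e.surjective j
        rw [ha]
        simp only [sub_re, ofReal_re, natCast_re, one_re]
        linarith [l.cast_nonneg (α := ℝ), (i : ℕ).cast_nonneg (α := ℝ)]
  · intro ζ hζ
    obtain ⟨u, rfl⟩ : ∃ u, ζ = u + β := ⟨ζ - β, by ring⟩
    have hu : u.re < 0 := by simpa using hζ
    set s : ℂ := (m + 1) / 2 + u with hs'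
    have hprod : ∏ j, Gamma (1 - a j + (u + β)) =
        Gamma (4 * s) * (2 : ℂ) ^ (5 / 2 - 8 * s) * (√π : ℝ) ^ 3 := by
      rw [← Gamma_quadruplication, ← Equiv.prod_comp e, Fin.prod_univ_four]
      simp only [ha]
      push_cast
      congr 1
      · congr 1
        · congr 1
          · congr 1; simp [hs']; ring
          · congr 1; simp [hs']; ring
        · congr 1; simp [hs']; ring
      · congr 1; simp [hs']; ring
    have hgam : Gamma (d 0 - (u + β)) / Gamma (1 - d' 0 + (u + β)) =
      Gamma (-(2 * u)) * (2 : ℂ) ^ (1 + 2 * u) * Complex.cos (π * u) / (√π : ℝ) := by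
      rw [← Gamma_neg_div_Gamma_half_add hu, hd, hd']
      congr 2 <;> ring
    have hcos : Complex.cos (π * (m + 1 - (m + 1 + (2 : ℝ) * (u + β - β))) / 2) =
        Complex.cos (π * u) := by
      rw [← Complex.cos_neg]; congr 1; push_cast; ring
    rw [meijerGIntegrand, hprod, cosKernel, hcos]
    simp only [Finset.univ_unique, Fin.default_eq_zero, Finset.prod_singleton,
      Finset.univ_eq_empty, Finset.prod_empty, mul_one]
    rw [mul_div_right_comm, hgam, hz, cpow_add _ _ hZ0]
    have e1 : (2 : ℂ) * (m + 1 + (2 : ℝ) * (u + β - β)) = 4 * s := by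
      rw [hs']; push_cast; ring
    have e2 : (m : ℂ) + 1 - (m + 1 + (2 : ℝ) * (u + β - β)) = -(2 * u) := by
      push_cast; ring
    rw [e1, e2]
    have e3 : (b : ℂ) ^ (2 * m + 2) * (b : ℂ) ^ (-(4 * s)) = (b : ℂ) ^ (-(4 * u)) := by
      rw [← cpow_natCast, ← cpow_add _ _ hb0]
      congr 1; rw [hs']; push_cast; ring
    -- All bases are positive, so `hlog` turns this into an identity between exponents that are
    -- linear in the logarithms of 2, A and b.
    have e4 : (2 : ℂ) ^ (1 + 2 * u) * (2 : ℂ) ^ (5 / 2 - 8 * s) * ((64 * A ^ 2 / b ^ 4 : ℝ) : ℂ) ^ u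
        = 2 * (2 : ℂ) ^ (-(4 * (m : ℂ) + 3 / 2)) * (b : ℂ) ^ (-(4 * u)) *
          (A : ℂ) ^ (- -(2 * u)) := by
      have h2 : 2 * (2 : ℂ) ^ (-(4 * (m : ℂ) + 3 / 2)) = 2 ^ (-(4 * (m : ℂ) + 3 / 2) + 1) := by
        rw [cpow_add _ _ two_ne_zero, cpow_one, mul_comm]
      rw [h2]
      rw [cpow_def_of_ne_zero hZ0, hlog]
      simp only [cpow_def_of_ne_zero two_ne_zero, cpow_def_of_ne_zero hb0,
        cpow_def_of_ne_zero hA0, ← exp_add]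
      congr 1
      rw [hs']; ring
    calc _ = ((64 * A ^ 2 / b ^ 4 : ℝ) : ℂ) ^ (β : ℂ) * Gamma (-(2 * u)) * Gamma (4 * s) *
          Complex.cos (π * u) * ((√π : ℝ) ^ 3 / (√π : ℝ)) * ((2 : ℂ) ^ (1 + 2 * u) *
            (2 : ℂ) ^ (5 / 2 - 8 * s) * ((64 * A ^ 2 / b ^ 4 : ℝ) : ℂ) ^ u) := by ring
      _ = ((64 * A ^ 2 / b ^ 4 : ℝ) : ℂ) ^ (β : ℂ) * Gamma (-(2 * u)) * Gamma (4 * s) *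
          Complex.cos (π * u) * π * (2 * (2 : ℂ) ^ (-(4 * (m : ℂ) + 3 / 2)) *
            ((b : ℂ) ^ (2 * m + 2) * (b : ℂ) ^ (-(4 * s))) * (A : ℂ) ^ (- -(2 * u))) := by
        rw [e4, e3, ← hss]; field_simp
      _ = _ := by ring

/-- Here v = m + 1 + 4u and s = (m+1)/4 + u, so the eight upper factors Γ(s + j/8) yield Γ(8s) =
Γ(2v). Duplication in numerator and denominator reduces the lower factors to Γ(-2u)/Γ(1/2 + 2u), and
`Gamma_neg_div_Gamma_half_add` at 2u gives Γ(-4u) cos(2πu). -/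
lemma meijerG_two_eight_eq {a : Fin 8 → ℂ} {d d' : Fin 2 → ℂ} {z : ℂ} {m : ℕ} {A b : ℝ}
    (hA : 0 < A) (hb : 0 < b) (ha : ∀ j, a j = (((6 - 2 * m - (j : ℕ)) / 8 : ℝ) : ℂ))
    (hd0 : d 0 = 0) (hd1 : d 1 = 1 / 2) (hd0' : d' 0 = 1 / 4) (hd1' : d' 1 = 3 / 4)
    (hz : z = ((4 ^ 8 * A ^ 4 / b ^ 8 : ℝ) : ℂ)) :
    MeijerGConverges a ![] d d' z ∧ meijerG a ![] d d' z =
      ((π ^ 3 * 2 ^ (-(6 * (m : ℝ) + 5 / 2)) * b ^ (2 * m + 2) *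
        cosSqrtIntegral m A b : ℝ) : ℂ) := by
  have hZ : 0 < 4 ^ 8 * A ^ 4 / b ^ 8 := by positivity
  have hss : ((√π : ℝ) : ℂ) * (√π : ℝ) = π := by
    exact_mod_cast Real.mul_self_sqrt Real.pi_pos.le
  have hs : ((√π : ℝ) : ℂ) ≠ 0 := by
    exact_mod_cast (Real.sqrt_pos.mpr Real.pi_pos).ne'
  have hb0 : (b : ℂ) ≠ 0 := by exact_mod_cast hb.ne'
  have hA0 : (A : ℂ) ≠ 0 := by exact_mod_cast hA.ne'
  have hlog : Complex.log ((4 ^ 8 * A ^ 4 / b ^ 8 : ℝ) : ℂ) =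
      16 * Complex.log 2 + 4 * Complex.log A - 8 * Complex.log b := by
    have h2 : Complex.log 2 = (Real.log 2 : ℝ) := by rw [ofReal_log zero_le_two, ofReal_ofNat]
    rw [← ofReal_log hZ.le, ← ofReal_log hA.le, ← ofReal_log hb.le, h2, Real.log_div (by positivity) (by positivity),
      Real.log_mul (by norm_num) (by positivity), show (4 : ℝ) = 2 ^ 2 by norm_num, ← pow_mul]
    simp only [Real.log_pow]
    push_cast
    ring
  have hZ0 : ((4 ^ 8 * A ^ 4 / b ^ 8 : ℝ) : ℂ) ≠ 0 := by exact_mod_cast hZ.ne'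
  have h := meijerG_of_integrand_eq_cosKernel (a := a) (a' := ![]) (d := d) (d' := d') (z := z)
    (K := π ^ 3 * (2 : ℂ) ^ (-(6 * (m : ℂ) + 1 / 2)) * (b : ℂ) ^ (2 * m + 2))
    (m := m) (q := 4) (β := 0) hA hb (by norm_num) ?_ ?_
  · refine ⟨h.1, h.2.trans ?_⟩
    have e1 : (2 : ℂ) ^ (-(6 * (m : ℂ) + 1 / 2)) / 4 = (2 : ℂ) ^ (-(6 * (m : ℂ) + 5 / 2)) := by
      rw [show -(6 * (m : ℂ) + 5 / 2) = -(6 * (m : ℂ) + 1 / 2) - (2 : ℕ) by push_cast; ring,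
        cpow_sub _ _ two_ne_zero, cpow_natCast]
      norm_num
    rw [ofReal_mul, ofReal_mul, ofReal_mul, ofReal_cpow zero_le_two]
    push_cast
    rw [← e1]
    ring
  · intro c
    rw [MeijerGSeparates]
    constructor
    · rintro ⟨h1, h2⟩
      have h1 := h1 0 0
      have h2 := h2 0 0
      rw [hd0] at h1
      rw [ha] at h2
      simp only [sub_re, ofReal_re] at h2
      simp at h1 h2
      exact ⟨by linarith, h1⟩
    · rintro ⟨h1, h2⟩
      refine ⟨fun j l => ?_, fun j l => ?_⟩
      · have hl := l.cast_nonneg (α := ℝ)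
        fin_cases j
        · simp only [Fin.zero_eta, hd0, zero_add, natCast_re]
          linarith
        · simp only [Fin.mk_one, hd1, add_re, natCast_re, div_ofNat_re, one_re]
          linarith
      · rw [ha]
        simp only [sub_re, ofReal_re, natCast_re, one_re]
        linarith [l.cast_nonneg (α := ℝ), (j : ℕ).cast_nonneg (α := ℝ)]
  · intro u hu
    set s : ℂ := (m + 1) / 4 + u with hs'
    have hprod : ∏ j, Gamma (1 - a j + u) =
        Gamma (8 * s) * (2 : ℂ) ^ (5 - 24 * s) * (√π : ℝ) ^ 7 := by
      have e : ∀ j : Fin 8, 1 - a j + u = s + (j : ℕ) / 8 := by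
        intro j; rw [ha, hs']; push_cast; ring
      rw [← Gamma_octuplication, Fin.prod_univ_eight]
      simp only [e]
      simp
      ring
    have hgam : Gamma (d 0 - u) * Gamma (d 1 - u) /
        (Gamma (1 - d' 0 + u) * Gamma (1 - d' 1 + u)) =
      Gamma (-(4 * u)) * (2 : ℂ) ^ (1 + 4 * u) * Complex.cos (2 * π * u) / (√π : ℝ) *
        2 ^ (1 / 2 + 4 * u) := by
      have h1 := Gamma_mul_Gamma_add_half (-u)
      have h2 := Gamma_mul_Gamma_add_half (1 / 4 + u)
      have h3 := Gamma_neg_div_Gamma_half_add (u := 2 * u) (by simp; linarith)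
      rw [show 2 * (2 * u) = 4 * u by ring, show (π : ℂ) * (2 * u) = 2 * π * u by ring] at h3
      rw [hd0, hd1, hd0', hd1', show 0 - u = -u by ring, show 1 / 2 - u = -u + 1 / 2 by ring,
        show 1 - 1 / 4 + u = 1 / 4 + u + 1 / 2 by ring, show 1 - 3 / 4 + u = 1 / 4 + u by ring,
        mul_comm (Gamma (1 / 4 + u + 1 / 2)), h1, h2, ← h3,
        show 2 * -u = -(2 * u) by ring, show 2 * (1 / 4 + u) = 1 / 2 + 2 * u by ring]
      have e : (2 : ℂ) ^ (1 - -(2 * u)) = 2 ^ (1 - (1 / 2 + 2 * u)) * 2 ^ (1 / 2 + 4 * u) := by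
        rw [← cpow_add _ _ two_ne_zero]; congr 1; ring
      have hne : (2 : ℂ) ^ (1 - (1 / 2 + 2 * u)) ≠ 0 := by
        rw [cpow_def_of_ne_zero two_ne_zero]; exact exp_ne_zero _
      rw [e, mul_assoc (Gamma (1 / 2 + 2 * u)), ← mul_assoc (Gamma (-(2 * u))),
        mul_right_comm, mul_assoc (Gamma _) _ (((√π : ℝ)) : ℂ), mul_assoc]
      field_simp
    have hcos : Complex.cos (π * (m + 1 - (m + 1 + (4 : ℝ) * (u - (0 : ℝ)))) / 2) =
        Complex.cos (2 * π * u) := by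
      rw [← Complex.cos_neg]; congr 1; push_cast; ring
    rw [meijerGIntegrand, hprod, cosKernel, hcos]
    simp only [Fin.prod_univ_two, Finset.univ_eq_empty, Finset.prod_empty, mul_one]
    rw [mul_div_right_comm, hgam, hz]
    have e1 : (2 : ℂ) * (m + 1 + (4 : ℝ) * (u - (0 : ℝ))) = 8 * s := by
      rw [hs']; push_cast; ring
    have e2 : (m : ℂ) + 1 - (m + 1 + (4 : ℝ) * (u - (0 : ℝ))) = -(4 * u) := by
      push_cast; ring
    rw [e1, e2]
    have e3 : (b : ℂ) ^ (2 * m + 2) * (b : ℂ) ^ (-(8 * s)) = (b : ℂ) ^ (-(8 * u)) := by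
      rw [← cpow_natCast, ← cpow_add _ _ hb0]
      congr 1; rw [hs']; push_cast; ring
    have e4 : (2 : ℂ) ^ (1 + 4 * u) * (2 : ℂ) ^ (1 / 2 + 4 * u) * (2 : ℂ) ^ (5 - 24 * s) *
          ((4 ^ 8 * A ^ 4 / b ^ 8 : ℝ) : ℂ) ^ u
        = 2 * (2 : ℂ) ^ (-(6 * (m : ℂ) + 1 / 2)) * (b : ℂ) ^ (-(8 * u)) *
          (A : ℂ) ^ (- -(4 * u)) := by
      have h2 : 2 * (2 : ℂ) ^ (-(6 * (m : ℂ) + 1 / 2)) = 2 ^ (-(6 * (m : ℂ) + 1 / 2) + 1) := by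
        rw [cpow_add _ _ two_ne_zero, cpow_one, mul_comm]
      rw [h2]
      rw [cpow_def_of_ne_zero hZ0, hlog]
      simp only [cpow_def_of_ne_zero two_ne_zero, cpow_def_of_ne_zero hb0,
        cpow_def_of_ne_zero hA0, ← exp_add]
      congr 1
      rw [hs']; ring
    calc _ = Gamma (-(4 * u)) * Gamma (8 * s) *
          Complex.cos (2 * π * u) * ((√π : ℝ) ^ 7 / (√π : ℝ)) * ((2 : ℂ) ^ (1 + 4 * u) *
            (2 : ℂ) ^ (1 / 2 + 4 * u) * (2 : ℂ) ^ (5 - 24 * s) *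
              ((4 ^ 8 * A ^ 4 / b ^ 8 : ℝ) : ℂ) ^ u) := by ring
      _ = Gamma (-(4 * u)) * Gamma (8 * s) *
          Complex.cos (2 * π * u) * π ^ 3 * (2 * (2 : ℂ) ^ (-(6 * (m : ℂ) + 1 / 2)) *
            ((b : ℂ) ^ (2 * m + 2) * (b : ℂ) ^ (-(8 * s))) * (A : ℂ) ^ (- -(4 * u))) := by
        rw [e4, e3, ← hss]; field_simp
      _ = _ := by ring

end MeijerG

/-! ### Absolute convergence and termwise integration. -/

section Summation

open MeasureTheory Set

lemma integrableOn_ramanujanIntegrand (m : ℕ) (n : ℝ) :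
    IntegrableOn (ramanujanIntegrand m n) (Ioi 0) := by
  have hb := integrableOn_rpow_mul_exp_neg_mul_rpow (p := 1 / 2) (s := m - 1 / 2) (b := π)
    (by linarith [m.cast_nonneg (α := ℝ)]) (by norm_num) Real.pi_pos
  refine Integrable.mono' (hb.div_const (2 * π)) ?_ ?_
  · unfold ramanujanIntegrand
    exact Measurable.aestronglyMeasurable (by fun_prop)
  · filter_upwards [self_mem_ae_restrict measurableSet_Ioi] with x hx
    have hx : 0 < x := hx
    have hs : 0 < √x := Real.sqrt_pos.mpr hx
    -- With y = π√x, e^(2y) - 1 = 2 e^y sinh y ≥ 2y e^y: one bound covers both the singularity at 0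
    -- and the decay at infinity.
    have hden : 2 * π * √x * Real.exp (π * √x) ≤ Real.exp (2 * π * √x) - 1 := by
      have h1 : π * √x ≤ Real.sinh (π * √x) := Real.self_le_sinh_iff.mpr (by positivity)
      have h2 : Real.exp (2 * π * √x) = Real.exp (π * √x) * Real.exp (π * √x) := by
        rw [← Real.exp_add]; congr 1; ring
      have h3 : Real.exp (π * √x) * Real.exp (-(π * √x)) = 1 := by
        rw [← Real.exp_add]; simp
      rw [Real.sinh_eq] at h1
      nlinarith [Real.exp_pos (π * √x)]
    have hpos : 0 < 2 * π * √x * Real.exp (π * √x) := by positivity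
    rw [ramanujanIntegrand, norm_div, norm_mul, Real.norm_of_nonneg (hpos.trans_le hden).le,
      Real.norm_of_nonneg (by positivity : 0 ≤ x ^ m), Real.rpow_sub hx, Real.rpow_natCast,
      ← Real.sqrt_eq_rpow, neg_mul, Real.exp_neg]
    calc x ^ m * ‖Real.cos (π * n * x)‖ / (Real.exp (2 * π * √x) - 1)
        ≤ x ^ m * 1 / (2 * π * √x * Real.exp (π * √x)) := by
          gcongr
          exact Real.abs_cos_le_one _
      _ = x ^ m / √x * (Real.exp (π * √x))⁻¹ / (2 * π) := by field_simp

lemma summable_one_div_mul_succ_pow {a : ℝ} (p : ℕ) (hp : 1 < p) :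
    Summable fun k : ℕ => 1 / (a + a * k) ^ p := by
  have h := ((summable_nat_add_iff 1).mpr (Real.summable_one_div_nat_pow.mpr hp)).mul_left (1 / a ^ p)
  refine h.congr fun k => ?_
  rw [one_div_mul_one_div, ← mul_pow]
  push_cast
  ring_nf

/-- Sum and integral may be exchanged because the k-th term has L¹ norm at most 2Γ(2m+2)/b_k^(2m+2),
which is summable as 2m + 2 ≥ 2. -/
lemma hasSum_cosSqrtIntegral (m : ℕ) (n : ℝ) :
    HasSum (fun k : ℕ => cosSqrtIntegral m (π * n) (2 * π + 2 * π * k)) (ramanujanRC m n) := by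
  have hb : ∀ k : ℕ, 0 < 2 * π + 2 * π * k := fun k => by positivity
  have hint := fun k : ℕ => integrableOn_pow_mul_exp_neg_mul_sqrt m (hb k)
  set F : ℕ → ℝ → ℝ := fun k x =>
    x ^ m * Real.cos (π * n * x) * Real.exp (-((2 * π + 2 * π * k) * √x)) with hF
  have hle : ∀ k, ∀ᵐ x ∂volume.restrict (Ioi (0 : ℝ)),
      ‖F k x‖ ≤ x ^ m * Real.exp (-((2 * π + 2 * π * k) * √x)) := by
    intro k
    filter_upwards [self_mem_ae_restrict measurableSet_Ioi] with x hx
    have hx : 0 < x := hx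
    simp only [hF, norm_mul, Real.norm_of_nonneg (pow_nonneg hx.le m), Real.norm_eq_abs,
      Real.abs_exp]
    gcongr
    exact mul_le_of_le_one_right (by positivity) (Real.abs_cos_le_one _)
  have hFint : ∀ k, IntegrableOn (F k) (Ioi 0) := fun k =>
    (hint k).mono' (Continuous.aestronglyMeasurable (by fun_prop)) (hle k)
  have hval : ∀ k : ℕ, ∫ x in Ioi (0 : ℝ), x ^ m * Real.exp (-((2 * π + 2 * π * k) * √x)) =
      1 / (2 * π + 2 * π * k) ^ (2 * m + 2) * (2 * Real.Gamma (2 * m + 2)) := by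
    intro k
    have h := integral_rpow_mul_exp_neg_mul_rpow (p := 1 / 2) (q := m) (by norm_num)
      (by linarith [m.cast_nonneg (α := ℝ)]) (hb k)
    have e : ((m : ℝ) + 1) / (1 / 2) = ((2 * m + 2 : ℕ) : ℝ) := by push_cast; ring
    rw [neg_div, e, Real.rpow_neg (hb k).le, Real.rpow_natCast] at h
    simp only [Real.rpow_natCast, ← Real.sqrt_eq_rpow, neg_mul] at h
    rw [h]
    push_cast
    ring
  have hsum : Summable fun k => ∫ x in Ioi (0 : ℝ), ‖F k x‖ := by
    refine Summable.of_nonneg_of_le (fun k => integral_nonneg fun x => norm_nonneg _)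
      (fun k => (integral_mono_ae (hFint k).norm (hint k) (hle k)).trans_eq (hval k)) ?_
    exact (summable_one_div_mul_succ_pow _ (by omega)).mul_right _
  have h := hasSum_integral_of_summable_integral_norm hFint hsum
  suffices hR : ramanujanRC m n = ∫ x in Ioi (0 : ℝ), ∑' k, F k x by
    rw [hR]
    exact h
  refine setIntegral_congr_fun measurableSet_Ioi fun x hx => ?_
  have hx : 0 < x := hx
  have hs : 0 < √x := Real.sqrt_pos.mpr hx
  have hlt : Real.exp (-(2 * π * √x)) < 1 := Real.exp_lt_one_iff.mpr (by
    have : 0 < 2 * π * √x := by positivity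
    linarith)
  have hgeo := (hasSum_geometric_of_lt_one (Real.exp_pos _).le hlt).mul_left
    (x ^ m * Real.cos (π * n * x) * Real.exp (-(2 * π * √x)))
  have hterm : ∀ k : ℕ, F k x = x ^ m * Real.cos (π * n * x) * Real.exp (-(2 * π * √x)) *
      Real.exp (-(2 * π * √x)) ^ k := by
    intro k
    rw [hF, ← Real.exp_nat_mul, mul_assoc (x ^ m * _), ← Real.exp_add]
    ring_nf
  simp only [hterm, hgeo.tsum_eq, ramanujanIntegrand]
  rw [Real.exp_neg] at hlt ⊢
  have h1 : 1 < Real.exp (2 * π * √x) := Real.one_lt_exp_iff.mpr (by positivity)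
  have h2 : Real.exp (2 * π * √x) - 1 ≠ 0 := by linarith
  have h3 : 1 - (Real.exp (2 * π * √x))⁻¹ ≠ 0 := by linarith
  have h4 := Real.exp_ne_zero (2 * π * √x)
  field_simp

end Summation

/-! ### Assembly of the five series. -/

theorem mainTheorem3 (m : ℕ) (n : ℚ) (hn : 0 < n) :
    MeasureTheory.IntegrableOn (ramanujanIntegrand m n) (Set.Ioi 0) ∧
    ((∀ k : ℕ, MeijerGConverges
          ![(2 - 2 * m) / 4, (1 - 2 * m) / 4, (-2 * m) / 4, (-1 - 2 * m) / 4] ![] ![0] ![1 / 2]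
          (64 * n ^ 2 * π ^ 2 / (2 * π + 2 * π * k) ^ 4)) ∧
      HasSum (fun k : ℕ => (((2 : ℝ) ^ (4 * (m : ℝ) + 5 / 2) / π : ℝ) : ℂ) *
        (1 / (2 * π + 2 * π * k) ^ (2 * m + 2) * meijerG
          ![(2 - 2 * m) / 4, (1 - 2 * m) / 4, (-2 * m) / 4, (-1 - 2 * m) / 4] ![] ![0] ![1 / 2]
          (64 * n ^ 2 * π ^ 2 / (2 * π + 2 * π * k) ^ 4)))
        (ramanujanRC m n : ℂ)) ∧
    ((∀ k : ℕ, MeijerGConverges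
          ![(1 - 2 * m) / 4, (-1 - 2 * m) / 4, (-2 * m) / 4, (-2 - 2 * m) / 4] ![] ![-1 / 4] ![1 / 4]
          (64 * n ^ 2 * π ^ 2 / (2 * π + 2 * π * k) ^ 4)) ∧
      HasSum (fun k : ℕ => (((2 : ℝ) ^ (4 * (m : ℝ) + 4) * Real.sqrt n / Real.sqrt π : ℝ) : ℂ) *
        (1 / (2 * π + 2 * π * k) ^ (2 * m + 3) * meijerG
          ![(1 - 2 * m) / 4, (-1 - 2 * m) / 4, (-2 * m) / 4, (-2 - 2 * m) / 4] ![] ![-1 / 4] ![1 / 4]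
          (64 * n ^ 2 * π ^ 2 / (2 * π + 2 * π * k) ^ 4)))
        (ramanujanRC m n : ℂ)) ∧
    ((∀ k : ℕ, MeijerGConverges
          ![(4 - 2 * m) / 4, (3 - 2 * m) / 4, (2 - 2 * m) / 4, (1 - 2 * m) / 4] ![] ![1 / 2] ![1]
          (64 * n ^ 2 * π ^ 2 / (2 * π + 2 * π * k) ^ 4)) ∧
      HasSum (fun k : ℕ => (((2 : ℝ) ^ (4 * (m : ℝ) - 1 / 2) / (n * π ^ 2) : ℝ) : ℂ) *
        (1 / (2 * π + 2 * π * k) ^ (2 * m) * meijerG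
          ![(4 - 2 * m) / 4, (3 - 2 * m) / 4, (2 - 2 * m) / 4, (1 - 2 * m) / 4] ![] ![1 / 2] ![1]
          (64 * n ^ 2 * π ^ 2 / (2 * π + 2 * π * k) ^ 4)))
        (ramanujanRC m n : ℂ)) ∧
    ((∀ k : ℕ, MeijerGConverges
          ![(-2 * m) / 4, (-1 - 2 * m) / 4, (-2 - 2 * m) / 4, (-3 - 2 * m) / 4] ![] ![-1 / 2] ![0]
          (64 * n ^ 2 * π ^ 2 / (2 * π + 2 * π * k) ^ 4)) ∧
      HasSum (fun k : ℕ => ((n * (2 : ℝ) ^ (4 * (m : ℝ) + 11 / 2) : ℝ) : ℂ) *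
        (1 / (2 * π + 2 * π * k) ^ (2 * m + 4) * meijerG
          ![(-2 * m) / 4, (-1 - 2 * m) / 4, (-2 - 2 * m) / 4, (-3 - 2 * m) / 4] ![] ![-1 / 2] ![0]
          (64 * n ^ 2 * π ^ 2 / (2 * π + 2 * π * k) ^ 4)))
        (ramanujanRC m n : ℂ)) ∧
    ((∀ k : ℕ, MeijerGConverges
          ![(6 - 2 * m) / 8, (5 - 2 * m) / 8, (4 - 2 * m) / 8, (3 - 2 * m) / 8,
            (2 - 2 * m) / 8, (1 - 2 * m) / 8, (-2 * m) / 8, (-1 - 2 * m) / 8] ![] ![0, 1 / 2] ![1 / 4, 3 / 4]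
          (4 ^ 8 * n ^ 4 * π ^ 4 / (2 * π + 2 * π * k) ^ 8)) ∧
      HasSum (fun k : ℕ => (((2 : ℝ) ^ (6 * (m : ℝ) + 5 / 2) / π ^ 3 : ℝ) : ℂ) *
        (1 / (2 * π + 2 * π * k) ^ (2 * m + 2) * meijerG
          ![(6 - 2 * m) / 8, (5 - 2 * m) / 8, (4 - 2 * m) / 8, (3 - 2 * m) / 8,
            (2 - 2 * m) / 8, (1 - 2 * m) / 8, (-2 * m) / 8, (-1 - 2 * m) / 8] ![] ![0, 1 / 2] ![1 / 4, 3 / 4]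
          (4 ^ 8 * n ^ 4 * π ^ 4 / (2 * π + 2 * π * k) ^ 8)))
        (ramanujanRC m n : ℂ)) := by
  have hn' : (0 : ℝ) < n := by exact_mod_cast hn
  have hA : 0 < π * (n : ℝ) := by positivity
  have hb : ∀ k : ℕ, 0 < 2 * π + 2 * π * k := fun k => by positivity
  have hS := hasSum_cosSqrtIntegral m n
  have hsum : ∀ f : ℕ → ℂ, (∀ k, f k = (cosSqrtIntegral m (π * n) (2 * π + 2 * π * k) : ℂ)) →
      HasSum f (ramanujanRC m n : ℂ) := fun f hf => by
    rw [funext hf]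
    exact Complex.hasSum_ofReal.mpr hS
  have hz : ∀ k : ℕ, (64 * n ^ 2 * π ^ 2 / (2 * π + 2 * π * k) ^ 4 : ℂ) =
      ((64 * (π * n) ^ 2 / (2 * π + 2 * π * k) ^ 4 : ℝ) : ℂ) := fun k => by push_cast; ring
  have hz' : ∀ k : ℕ, (4 ^ 8 * n ^ 4 * π ^ 4 / (2 * π + 2 * π * k) ^ 8 : ℂ) =
      ((4 ^ 8 * (π * n) ^ 4 / (2 * π + 2 * π * k) ^ 8 : ℝ) : ℂ) := fun k => by push_cast; ring
  have h1 := fun k : ℕ => meijerG_one_four_eq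
    (a := ![(2 - 2 * m) / 4, (1 - 2 * m) / 4, (-2 * m) / 4, (-1 - 2 * m) / 4])
    (d := ![0]) (d' := ![1 / 2]) (m := m) (β := 0) hA (hb k) (Equiv.refl _)
    (by intro j; fin_cases j <;> simp <;> ring) (by simp) (by simp) (hz k)
  -- The second series lists its two middle upper parameters in increasing order, hence the
  -- transposition.
  have h2 := fun k : ℕ => meijerG_one_four_eq
    (a := ![(1 - 2 * m) / 4, (-1 - 2 * m) / 4, (-2 * m) / 4, (-2 - 2 * m) / 4])
    (d := ![-1 / 4]) (d' := ![1 / 4]) (m := m) (β := -1 / 4) hA (hb k) (Equiv.swap 1 2)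
    (by
      have e0 : Equiv.swap (1 : Fin 4) 2 0 = 0 := by decide
      have e3 : Equiv.swap (1 : Fin 4) 2 3 = 3 := by decide
      intro j; fin_cases j <;> simp [e0, e3] <;> ring)
    (by simp) (by simp; ring) (hz k)
  have h3 := fun k : ℕ => meijerG_one_four_eq
    (a := ![(4 - 2 * m) / 4, (3 - 2 * m) / 4, (2 - 2 * m) / 4, (1 - 2 * m) / 4])
    (d := ![1 / 2]) (d' := ![1]) (m := m) (β := 1 / 2) hA (hb k) (Equiv.refl _)
    (by intro j; fin_cases j <;> simp <;> ring) (by simp) (by simp; ring) (hz k)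
  have h4 := fun k : ℕ => meijerG_one_four_eq
    (a := ![(-2 * m) / 4, (-1 - 2 * m) / 4, (-2 - 2 * m) / 4, (-3 - 2 * m) / 4])
    (d := ![-1 / 2]) (d' := ![0]) (m := m) (β := -1 / 2) hA (hb k) (Equiv.refl _)
    (by intro j; fin_cases j <;> simp <;> ring) (by simp) (by simp; ring) (hz k)
  have h5 := fun k : ℕ => meijerG_two_eight_eq
    (a := ![(6 - 2 * m) / 8, (5 - 2 * m) / 8, (4 - 2 * m) / 8, (3 - 2 * m) / 8,
            (2 - 2 * m) / 8, (1 - 2 * m) / 8, (-2 * m) / 8, (-1 - 2 * m) / 8])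
    (d := ![0, 1 / 2]) (d' := ![1 / 4, 3 / 4]) (m := m) hA (hb k)
    (by intro j; fin_cases j <;> simp <;> ring) (by simp) (by simp) (by simp) (by simp) (hz' k)
  -- This leaves, for each series, only the identity that the prefactor cancels the constant in the
  -- G-value.
  have hconst : ∀ (k p : ℕ) (c d : ℝ) (G : ℂ),
      G = ((d * cosSqrtIntegral m (π * n) (2 * π + 2 * π * k) : ℝ) : ℂ) →
      c * (1 / (2 * π + 2 * π * k) ^ p * d) = 1 →
      (c : ℂ) * (1 / (2 * π + 2 * π * k) ^ p * G) =
        (cosSqrtIntegral m (π * n) (2 * π + 2 * π * k) : ℂ) := by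
    intro k p c d G hG hc
    have : (c : ℂ) * (1 / (2 * π + 2 * π * k) ^ p * d) = 1 := by exact_mod_cast hc
    rw [hG]
    push_cast
    linear_combination (cosSqrtIntegral m (π * n) (2 * π + 2 * π * k) : ℂ) * this
  -- With 2, π, n and b_k written as exponentials, each identity of constants says that a total
  -- exponent is zero, which `ring` decides.
  obtain ⟨l, hl⟩ : ∃ l, (2 : ℝ) = Real.exp l := ⟨_, (Real.exp_log two_pos).symm⟩
  obtain ⟨p, hp⟩ : ∃ p, π = Real.exp p := ⟨_, (Real.exp_log Real.pi_pos).symm⟩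
  obtain ⟨ν, hν⟩ : ∃ ν, (n : ℝ) = Real.exp ν := ⟨_, (Real.exp_log hn').symm⟩
  have hsqrt : ∀ x, √(Real.exp x) = Real.exp (x / 2) := fun x => (Real.exp_half x).symm
  have key : ∀ k : ℕ, ∃ B, 2 * π + 2 * π * k = Real.exp B ∧ 64 * (π * n) ^ 2 /
      (2 * π + 2 * π * k) ^ 4 = Real.exp (6 * l + 2 * (p + ν) - 4 * B) := by
    intro k
    obtain ⟨B, hB⟩ : ∃ B, 2 * π + 2 * π * k = Real.exp B := ⟨_, (Real.exp_log (hb k)).symm⟩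
    refine ⟨B, hB, ?_⟩
    rw [Real.exp_sub, Real.exp_add, mul_add 2, Real.exp_add, show (6 : ℝ) = (6 : ℕ) by norm_num,
      show (4 : ℝ) * B = (4 : ℕ) * B by norm_num,
      show (2 : ℝ) * p = (2 : ℕ) * p by norm_num, show (2 : ℝ) * ν = (2 : ℕ) * ν by norm_num,
      Real.exp_nat_mul, Real.exp_nat_mul, Real.exp_nat_mul, Real.exp_nat_mul,
      ← hB, ← hl, ← hp, ← hν]
    ring
  have h2e : ∀ x : ℝ, (2 : ℝ) ^ x = Real.exp (l * x) := fun x => by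
    rw [Real.exp_mul, ← hl]
  have hpe : ∀ j : ℕ, π ^ j = Real.exp (j * p) := fun j => by rw [Real.exp_nat_mul, ← hp]
  refine ⟨integrableOn_ramanujanIntegrand m n,
    ⟨fun k => (h1 k).1, hsum _ fun k => hconst k _ _ _ _ (h1 k).2 ?_⟩,
    ⟨fun k => (h2 k).1, hsum _ fun k => hconst k _ _ _ _ (h2 k).2 ?_⟩,
    ⟨fun k => (h3 k).1, hsum _ fun k => hconst k _ _ _ _ (h3 k).2 ?_⟩,
    ⟨fun k => (h4 k).1, hsum _ fun k => hconst k _ _ _ _ (h4 k).2 ?_⟩,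
    ⟨fun k => (h5 k).1, hsum _ fun k => hconst k _ _ _ _ (h5 k).2 ?_⟩⟩
  all_goals
    obtain ⟨B, hB, hZ⟩ := key k
    try rw [hZ]
    rw [hB]
    simp only [h2e, hpe, hν, hsqrt]
    try rw [hp]
    simp only [hsqrt, ← Real.exp_mul, ← Real.exp_add, ← Real.exp_sub, ← Real.exp_nat_mul, one_div,
      ← Real.exp_neg]
    rw [Real.exp_eq_one_iff]
    push_cast
    ring
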